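/- **Lemma 2.1.** Let $L_1$ and $L_2$ be nontrivial finite transitive permutation groups and let $B$ be a finite group. The following are equivalent: 1. there exists a faithful rank two amalgam of permutation type $[L_1,L_2]$ whose Borel subgroup is isomorphic to $B$; 2. there exists a locally $[L_1,L_2]$ pair $(\mathfrak T,G)$ such that $\mathfrak T$ is an infinite tree and $G_{uv}\cong B$ for some edge $\{u,v\}$ of $\mathfrak T$; 3. there exists a locally $[L_1,L_2]$ pair $(\Gamma,H)$ such that $\Gamma$ is finite and $H_{uv}\cong B$ for some edge $\{u,v\}$ of $\Gamma$. Here $[L_1,L_2]$ denotes the multiset consisting of $L_1$ and $L_2$, and permutation groups are considered up to permutation isomorphism. *Amalgams.* A rank two amalgam is a finite set $\mathcal A$ with two subsets $P_1,P_2$, each carrying a group structure, such that $P_1\cup P_2=\mathcal A$, $P_1\cap P_2\neq\emptyset$, and the operations of $P_1$ and $P_2$ coincide on $P_1\cap P_2$. Its Borel subgroup is $\mathcal B=P_1\cap P_2$. It is faithful if no nontrivial subgroup of $\mathcal B$ is normalised by both $P_1$ and $P_2$. Its permutation type is the multiset of the two permutation groups induced by $P_1$ and $P_2$ on the cosets of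 $\mathcal B$ in $P_1$ and in $P_2$ respectively. *Graphs.* All graphs are connected, simple and locally finite. For a graph $\Gamma$ and a group $G$ of automorphisms of $\Gamma$, $G_v$ is the stabiliser of the vertex $v$, $G_{uv}=G_u\cap G_v$, and $G_v^{\Gamma(v)}$ is the permutation group induced by $G_v$ on the neighbourhood $\Gamma(v)$ of $v$. The pair $(\Gamma,G)$ is locally $[L_1,L_2]$ if $G_v^{\Gamma(v)}$ is transitive for every vertex $v$ and, for some edge $\{u,v\}$, there are permutation isomorphisms $G_u^{\Gamma(u)}\cong L_1$ and $G_v^{\Gamma(v)}\cong L_2$. -/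

import Mathlib

/-- Two permutation groups `L ≤ Sym(Ω)` and `M ≤ Sym(Δ)` are permutation isomorphic: there are a
bijection of the points and a group isomorphism that intertwine the two actions. -/
def PermIso {Ω Δ : Type*} (L : Subgroup (Equiv.Perm Ω)) (M : Subgroup (Equiv.Perm Δ)) : Prop :=
  ∃ (e : Ω ≃ Δ) (φ : L ≃* M), ∀ (g : L) (x : Ω),
    e ((g : Equiv.Perm Ω) x) = (φ g : Equiv.Perm Δ) (e x)

section Amalgams

/-- A rank `k` amalgam on the finite set `A`: subsets `P i` (`i < k`), each carrying a group
structure, covering `A`, with nonempty common intersection, such that the operations of `P i` and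
`P j` coincide on `P i ∩ P j`. -/
structure Amalgam (k : ℕ) (A : Type*) where
  finite : Finite A
  P : Fin k → Set A
  group : ∀ i, Group (P i)
  iUnion_eq : ⋃ i, P i = Set.univ
  iInter_nonempty : (⋂ i, P i).Nonempty
  mul_compat : ∀ (i j : Fin k) (x y : A) (hxi : x ∈ P i) (hxj : x ∈ P j)
    (hyi : y ∈ P i) (hyj : y ∈ P j),
    (((⟨x, hxi⟩ : P i) * (⟨y, hyi⟩ : P i) : P i) : A) =
      (((⟨x, hxj⟩ : P j) * (⟨y, hyj⟩ : P j) : P j) : A)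

namespace Amalgam

attribute [instance] Amalgam.group

variable {k : ℕ} {A : Type*} (𝒜 : Amalgam k A)

theorem mul_mem_inter (i : Fin k) (x y : 𝒜.P i) (hx : (x : A) ∈ ⋂ j, 𝒜.P j)
    (hy : (y : A) ∈ ⋂ j, 𝒜.P j) : ((x * y : 𝒜.P i) : A) ∈ ⋂ j, 𝒜.P j := by
  rw [Set.mem_iInter] at hx hy ⊢
  intro j
  have h := 𝒜.mul_compat i j x y x.2 (hx j) y.2 (hy j)
  simp only [Subtype.coe_eta] at h
  rw [h]
  exact Subtype.coe_prop _

theorem pow_mem_inter (i : Fin k) (x : 𝒜.P i) (hx : (x : A) ∈ ⋂ j, 𝒜.P j) (n : ℕ) :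
    ((x ^ (n + 1) : 𝒜.P i) : A) ∈ ⋂ j, 𝒜.P j := by
  induction n with
  | zero => simpa using hx
  | succ n ih =>
    rw [pow_succ]
    exact 𝒜.mul_mem_inter i _ _ ih hx

theorem one_mem_inter (i : Fin k) : ((1 : 𝒜.P i) : A) ∈ ⋂ j, 𝒜.P j := by
  obtain ⟨x, hx⟩ := 𝒜.iInter_nonempty
  have := 𝒜.finite
  let x' : 𝒜.P i := ⟨x, Set.mem_iInter.1 hx i⟩
  obtain ⟨n, hn⟩ := Nat.exists_eq_succ_of_ne_zero (orderOf_pos x').ne'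
  have h := 𝒜.pow_mem_inter i x' hx n
  have h1 : x' ^ (n + 1) = 1 := by
    rw [← Nat.succ_eq_add_one, ← hn]
    exact pow_orderOf_eq_one x'
  rwa [h1] at h

theorem inv_mem_inter (i : Fin k) (x : 𝒜.P i) (hx : (x : A) ∈ ⋂ j, 𝒜.P j) :
    ((x⁻¹ : 𝒜.P i) : A) ∈ ⋂ j, 𝒜.P j := by
  have := 𝒜.finite
  obtain ⟨n, hn⟩ := Nat.exists_eq_succ_of_ne_zero (orderOf_pos x).ne'
  have h1 : x⁻¹ = x ^ n := by
    rw [inv_eq_iff_mul_eq_one, ← pow_succ', ← Nat.succ_eq_add_one, ← hn]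
    exact pow_orderOf_eq_one x
  rw [h1]
  cases n with
  | zero => simpa using 𝒜.one_mem_inter i
  | succ n => exact 𝒜.pow_mem_inter i x hx n

/-- The Borel subgroup `⋂ j, P j`, as a subgroup of the group `P i`. -/
def borel (i : Fin k) : Subgroup (𝒜.P i) where
  carrier := {x | (x : A) ∈ ⋂ j, 𝒜.P j}
  mul_mem' {x y} hx hy := 𝒜.mul_mem_inter i x y hx hy
  one_mem' := 𝒜.one_mem_inter i
  inv_mem' {x} hx := 𝒜.inv_mem_inter i x hx

/-- The Borel subgroup of the amalgam is (isomorphic to) the group `B`. The group structures that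
the set `⋂ j, P j` inherits from the various `P i` are all the same. -/
def HasBorel (B : Type*) [Group B] : Prop :=
  ∀ i, Nonempty (𝒜.borel i ≃* B)

/-- The amalgam is faithful: a subset `N` of `⋂ j, P j` which is a normal subgroup
of every `P i` is trivial. -/
def Faithful : Prop :=
  ∀ N : Set A, N ⊆ ⋂ j, 𝒜.P j →
    (∀ i, ∃ M : Subgroup (𝒜.P i), M.Normal ∧ Subtype.val '' (M : Set (𝒜.P i)) = N) →
    N.Subsingleton

/-- The permutation group induced by `P i` on the cosets of the Borel subgroup in `P i`.
(Mathlib's coset space consists of left cosets, acted on by left multiplication; the map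
`x B ↦ B x⁻¹` identifies this with the action by right multiplication on the right cosets.) -/
def cosetGroup (i : Fin k) : Subgroup (Equiv.Perm (𝒜.P i ⧸ 𝒜.borel i)) :=
  (MulAction.toPermHom (𝒜.P i) (𝒜.P i ⧸ 𝒜.borel i)).range

end Amalgam

/-- The rank two amalgam has permutation type the multiset `[L₁, L₂]`. -/
def Amalgam.HasPermType {A : Type*} (𝒜 : Amalgam 2 A) {Ω₁ Ω₂ : Type*}
    (L₁ : Subgroup (Equiv.Perm Ω₁)) (L₂ : Subgroup (Equiv.Perm Ω₂)) : Prop :=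
  (PermIso (𝒜.cosetGroup 0) L₁ ∧ PermIso (𝒜.cosetGroup 1) L₂) ∨
    (PermIso (𝒜.cosetGroup 0) L₂ ∧ PermIso (𝒜.cosetGroup 1) L₁)

end Amalgams

section Graphs

variable {V : Type*} (Γ : SimpleGraph V) (G : Subgroup (Γ ≃g Γ))

/-- The vertex-stabiliser `G_v`, a subgroup of the automorphism group of `Γ`. -/
def vertexStab (v : V) : Subgroup (Γ ≃g Γ) where
  carrier := {g | g ∈ G ∧ g v = v}
  mul_mem' {a b} ha hb := ⟨G.mul_mem ha.1 hb.1, by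
    rw [RelIso.mul_apply, hb.2, ha.2]⟩
  one_mem' := ⟨G.one_mem, rfl⟩
  inv_mem' {a} ha := ⟨G.inv_mem ha.1, by
    have h : a⁻¹ (a v) = v := RelIso.inv_apply_self a v
    rwa [ha.2] at h⟩

/-- The edge-stabiliser `G_{uv} = G_u ∩ G_v`. -/
def edgeStab (u v : V) : Subgroup (Γ ≃g Γ) :=
  vertexStab Γ G u ⊓ vertexStab Γ G v

/-- The permutation group `G_v^{Γ(v)}` induced by `G_v` on the neighbourhood `Γ(v)`: the
permutations of `Γ(v)` that are restrictions of elements of `G_v`. -/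
def localGroup (v : V) : Subgroup (Equiv.Perm (Γ.neighborSet v)) where
  carrier := {σ | ∃ g ∈ vertexStab Γ G v, ∀ x : Γ.neighborSet v, ((σ x : V)) = g (x : V)}
  mul_mem' := by
    rintro σ τ ⟨g, hg, hσ⟩ ⟨h, hh, hτ⟩
    refine ⟨g * h, mul_mem hg hh, fun x => ?_⟩
    rw [Equiv.Perm.mul_apply, hσ, hτ, RelIso.mul_apply]
  one_mem' := ⟨1, one_mem _, fun _ => rfl⟩
  inv_mem' := by
    rintro σ ⟨g, hg, hσ⟩
    refine ⟨g⁻¹, inv_mem hg, fun x => ?_⟩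
    have h := hσ (σ⁻¹ x)
    rw [← Equiv.Perm.mul_apply, mul_inv_cancel, Equiv.Perm.one_apply] at h
    rw [h, RelIso.inv_apply_self]

/-- `Γ` is `G`-locally-transitive. -/
def IsLocallyTransitive : Prop :=
  ∀ v, MulAction.IsPretransitive (localGroup Γ G v) (Γ.neighborSet v)

/-- `(Γ, G)` is a locally `[L₁, L₂]` pair: `Γ` is a connected, locally finite (simple) graph which
is `G`-locally-transitive and, for some edge `{u, v}`, the local groups at `u` and `v` are
permutation isomorphic to `L₁` and `L₂`. -/
structure IsLocallyPair {Ω₁ Ω₂ : Type*}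
    (L₁ : Subgroup (Equiv.Perm Ω₁)) (L₂ : Subgroup (Equiv.Perm Ω₂)) : Prop where
  connected : Γ.Connected
  locallyFinite : ∀ v, (Γ.neighborSet v).Finite
  locallyTransitive : IsLocallyTransitive Γ G
  exists_edge : ∃ u v, Γ.Adj u v ∧ PermIso (localGroup Γ G u) L₁ ∧ PermIso (localGroup Γ G v) L₂

end Graphs

/-! A locally transitive pair is transitive on edges, so it is governed by the stabilisers of the
two ends of one edge, glued along the edge stabiliser.

From graph to amalgam: `G_u` and `G_v` form an amalgam with Borel subgroup `G_uv`, and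
orbit-stabiliser identifies the coset actions with the local actions (`permIso_cosets_localGroup`).
A subgroup of `G_uv` normal in both fixes `u` and `v`; every vertex is a translate of `u` or `v`
under its normaliser, so it fixes everything (`faithful_of_edge`).

From amalgam to graph: let `Q` be generated by copies of `P 0` and `P 1` that meet exactly in the
Borel subgroup (`IsCompletion`). Then `Q` acts on the graph of cosets of `P 0` and `P 1` with the
required local actions and edge stabiliser; the kernel lies in the Borel subgroup and is normal,
hence trivial by faithfulness. Two choices of `Q` suffice. The amalgamated product gives a tree, by
the normal form theorem (`treeGraph_isAcyclic`), which has no leaves and so is infinite. Its image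
in the symmetric group of a finite set, built from transversals of the Borel subgroup, gives a
finite graph (`exists_finite_permRep`). -/

section PermIso

variable {Ω Δ Θ : Type*} {L : Subgroup (Equiv.Perm Ω)} {M : Subgroup (Equiv.Perm Δ)}
  {K : Subgroup (Equiv.Perm Θ)}

theorem PermIso.symm (h : PermIso L M) : PermIso M L := by
  obtain ⟨e, φ, h⟩ := h
  refine ⟨e.symm, φ.symm, fun g x => ?_⟩
  rw [Equiv.symm_apply_eq, h, MulEquiv.apply_symm_apply, Equiv.apply_symm_apply]

theorem PermIso.trans (h : PermIso L M) (h' : PermIso M K) : PermIso L K := by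
  obtain ⟨e, φ, h⟩ := h
  obtain ⟨e', φ', h'⟩ := h'
  exact ⟨e.trans e', φ.trans φ', fun g x => by simp [h, h']⟩

theorem PermIso.of_map_permCongr (e : Ω ≃ Δ)
    (h : L.map (e.permCongrHom : Equiv.Perm Ω →* Equiv.Perm Δ) = M) : PermIso L M := by
  subst h
  refine ⟨e, L.equivMapOfInjective _ e.permCongrHom.injective, fun g x => ?_⟩
  simp

end PermIso

/-! ### Local actions, orbit-stabiliser and edge-transitivity. -/

section LocalAction

variable {V : Type*} {Γ : SimpleGraph V} {G : Subgroup (Γ ≃g Γ)}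

theorem mem_vertexStab {v : V} {g : Γ ≃g Γ} : g ∈ vertexStab Γ G v ↔ g ∈ G ∧ g v = v := Iff.rfl

theorem mem_edgeStab {u v : V} {g : Γ ≃g Γ} :
    g ∈ edgeStab Γ G u v ↔ g ∈ G ∧ g u = u ∧ g v = v := by
  rw [edgeStab, Subgroup.mem_inf, mem_vertexStab, mem_vertexStab]
  tauto

/-- A group acting through automorphisms that fix `v` acts on the neighbourhood of `v`. -/
def neighborAction {P : Type*} [Group P] (f : P →* (Γ ≃g Γ)) {v : V} (hf : ∀ p, f p v = v) :
    P →* Equiv.Perm (Γ.neighborSet v) where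
  toFun p :=
    { toFun := fun x => ⟨f p x, by
        have h := (f p).map_adj_iff.2 x.2
        rwa [hf] at h⟩
      invFun := fun x => ⟨f p⁻¹ x, by
        have h := (f p⁻¹).map_adj_iff.2 x.2
        rwa [hf] at h⟩
      left_inv := fun x => Subtype.ext (by simp [map_inv, RelIso.inv_apply_self])
      right_inv := fun x => Subtype.ext (by simp [map_inv, RelIso.apply_inv_self]) }
  map_one' := by ext; simp
  map_mul' p q := by ext; simp [RelIso.mul_apply]

theorem neighborAction_apply {P : Type*} [Group P] (f : P →* (Γ ≃g Γ)) {v : V}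
    (hf : ∀ p, f p v = v) (p : P) (x : Γ.neighborSet v) :
    (neighborAction f hf p x : V) = f p x := rfl

theorem neighborAction_range {P : Type*} [Group P] (f : P →* (Γ ≃g Γ)) {v : V}
    (hf : ∀ p, f p v = v) (hr : f.range = vertexStab Γ G v) :
    (neighborAction f hf).range = localGroup Γ G v := by
  ext σ
  constructor
  · rintro ⟨p, rfl⟩
    exact ⟨f p, hr ▸ ⟨p, rfl⟩, fun _ => rfl⟩
  · rintro ⟨g, hg, hσ⟩
    rw [← hr] at hg
    obtain ⟨p, rfl⟩ := hg
    exact ⟨p, Equiv.ext fun x => Subtype.ext (hσ x).symm⟩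

theorem isPretransitive_localGroup_iff {v : V} :
    MulAction.IsPretransitive (localGroup Γ G v) (Γ.neighborSet v) ↔
      ∀ x y, Γ.Adj v x → Γ.Adj v y → ∃ g ∈ vertexStab Γ G v, g x = y := by
  constructor
  · intro h x y hx hy
    obtain ⟨⟨σ, g, hg, hσ⟩, h⟩ := h.exists_smul_eq ⟨x, hx⟩ ⟨y, hy⟩
    exact ⟨g, hg, (hσ ⟨x, hx⟩).symm.trans (congrArg Subtype.val h)⟩
  · refine fun h => ⟨fun x y => ?_⟩
    obtain ⟨g, hg, hxy⟩ := h x y x.2 y.2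
    have hf : ∀ p : vertexStab Γ G v, (vertexStab Γ G v).subtype p v = v := fun p => p.2.2
    have hr := neighborAction_range (G := G) _ hf (Subgroup.range_subtype _)
    exact ⟨⟨neighborAction _ hf ⟨g, hg⟩, hr ▸ ⟨_, rfl⟩⟩, Subtype.ext hxy⟩

section CosetAction

variable {P : Type*} [Group P] (f : P →* (Γ ≃g Γ)) {u v : V} {C : Subgroup P}

/-- The neighbourhood of a vertex, as the coset space of an edge-stabiliser. -/
noncomputable def quotientEquivNeighborSet (huv : Γ.Adj u v) (hf : ∀ p, f p u = u)
    (hC : ∀ p, p ∈ C ↔ f p v = v) (ht : ∀ w, Γ.Adj u w → ∃ p, f p v = w) :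
    P ⧸ C ≃ Γ.neighborSet u :=
  Equiv.ofBijective
    (fun q => Quotient.liftOn' q (fun p => neighborAction f hf p ⟨v, huv⟩) fun p q hpq => by
      rw [QuotientGroup.leftRel_apply, hC, map_mul, map_inv, RelIso.mul_apply] at hpq
      apply Subtype.ext
      rw [neighborAction_apply, neighborAction_apply]
      have h := congrArg (f p) hpq
      rw [RelIso.apply_inv_self] at h
      exact h.symm)
    (by
      constructor
      · intro a b
        induction a using QuotientGroup.induction_on with | _ p =>
        induction b using QuotientGroup.induction_on with | _ q =>
        intro h
        have h : f p v = f q v := congrArg Subtype.val h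
        rw [QuotientGroup.eq, hC, map_mul, map_inv, RelIso.mul_apply, ← h, RelIso.inv_apply_self]
      · rintro ⟨w, hw⟩
        obtain ⟨p, hp⟩ := ht w hw
        exact ⟨QuotientGroup.mk p, Subtype.ext hp⟩)

/-- Orbit-stabiliser, equivariantly. It serves both directions: `P` is a member of an amalgam,
mapped onto a vertex stabiliser by inclusion or through the coset graph. -/
theorem permIso_cosets_localGroup (huv : Γ.Adj u v) (hr : f.range = vertexStab Γ G u)
    (hC : ∀ p, p ∈ C ↔ f p v = v) (ht : ∀ w, Γ.Adj u w → ∃ p, f p v = w) :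
    PermIso (MulAction.toPermHom P (P ⧸ C)).range (localGroup Γ G u) := by
  have hf : ∀ p, f p u = u := fun p => (hr ▸ ⟨p, rfl⟩ : f p ∈ vertexStab Γ G u).2
  refine PermIso.of_map_permCongr (quotientEquivNeighborSet f huv hf hC ht) ?_
  rw [← neighborAction_range f hf hr, MonoidHom.map_range]
  congr 1
  ext p x
  obtain ⟨q, rfl⟩ := (quotientEquivNeighborSet f huv hf hC ht).surjective x
  induction q using QuotientGroup.induction_on with | _ q =>
  change ((Equiv.permCongr (quotientEquivNeighborSet f huv hf hC ht)
    (MulAction.toPerm p)) _ : V) = _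
  rw [Equiv.permCongr_apply, Equiv.symm_apply_apply]
  change f (p * q) v = f p (f q v)
  rw [map_mul, RelIso.mul_apply]

end CosetAction

/-- Transitivity at `u` and `v` transports to all their translates, so the union of the two orbits
is closed under adjacency. The group `K` is kept general because it is also taken to be a
normaliser. -/
theorem exists_mem_eq_or_eq {K : Subgroup (Γ ≃g Γ)} {u v : V} (hΓ : Γ.Connected)
    (hu : ∀ x, Γ.Adj u x → ∃ g ∈ K, g u = u ∧ g v = x)
    (hv : ∀ x, Γ.Adj v x → ∃ g ∈ K, g v = v ∧ g u = x) (x : V) :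
    ∃ k ∈ K, k u = x ∨ k v = x := by
  have key : ∀ a b, Γ.Reachable a b → (∃ k ∈ K, k u = a ∨ k v = a) →
      ∃ k ∈ K, k u = b ∨ k v = b := by
    rintro a b ⟨p⟩
    induction p with
    | nil => exact id
    | @cons a b c h p ih =>
      refine fun ha => ih ?_
      obtain ⟨k, hk, rfl | rfl⟩ := ha
      · obtain ⟨g, hg, -, hx⟩ := hu (k⁻¹ b) (by
          rw [← k.map_adj_iff, RelIso.apply_inv_self]; exact h)
        exact ⟨k * g, mul_mem hk hg, Or.inr (by
          rw [RelIso.mul_apply, hx, RelIso.apply_inv_self])⟩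
      · obtain ⟨g, hg, -, hx⟩ := hv (k⁻¹ b) (by
          rw [← k.map_adj_iff, RelIso.apply_inv_self]; exact h)
        exact ⟨k * g, mul_mem hk hg, Or.inl (by
          rw [RelIso.mul_apply, hx, RelIso.apply_inv_self])⟩
  exact key u x (hΓ.preconnected u x) ⟨1, one_mem _, Or.inl rfl⟩

theorem IsLocallyTransitive.exists_mem_adj (h : IsLocallyTransitive Γ G) {u v : V}
    (huv : Γ.Adj u v) (x : V) (hx : Γ.Adj u x) : ∃ g ∈ vertexStab Γ G u, g v = x :=
  isPretransitive_localGroup_iff.1 (h u) v x huv hx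

/-- A locally transitive group of automorphisms of a connected graph is transitive on edges. -/
theorem IsLocallyTransitive.exists_map_edge (h : IsLocallyTransitive Γ G) (hΓ : Γ.Connected)
    {u v a b : V} (huv : Γ.Adj u v) (hab : Γ.Adj a b) :
    ∃ g ∈ G, (g u = a ∧ g v = b) ∨ (g u = b ∧ g v = a) := by
  obtain ⟨k, hk, rfl | rfl⟩ := exists_mem_eq_or_eq (K := G) hΓ
    (fun x hx => (h.exists_mem_adj huv x hx).imp fun g hg => ⟨hg.1.1, hg.1.2, hg.2⟩)
    (fun x hx => (h.exists_mem_adj huv.symm x hx).imp fun g hg => ⟨hg.1.1, hg.1.2, hg.2⟩) a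
  · obtain ⟨g, hg, hx⟩ := h.exists_mem_adj huv (k⁻¹ b) (by
      rw [← k.map_adj_iff, RelIso.apply_inv_self]; exact hab)
    exact ⟨k * g, mul_mem hk hg.1, Or.inl
      ⟨by rw [RelIso.mul_apply, hg.2], by rw [RelIso.mul_apply, hx, RelIso.apply_inv_self]⟩⟩
  · obtain ⟨g, hg, hx⟩ := h.exists_mem_adj huv.symm (k⁻¹ b) (by
      rw [← k.map_adj_iff, RelIso.apply_inv_self]; exact hab)
    exact ⟨k * g, mul_mem hk hg.1, Or.inr
      ⟨by rw [RelIso.mul_apply, hx, RelIso.apply_inv_self], by rw [RelIso.mul_apply, hg.2]⟩⟩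

theorem edgeStab_comm (u v : V) : edgeStab Γ G u v = edgeStab Γ G v u := inf_comm _ _

theorem edgeStab_map_conj {g : Γ ≃g Γ} (hg : g ∈ G) (u v : V) :
    (edgeStab Γ G u v).map (MulAut.conj g : (Γ ≃g Γ) →* (Γ ≃g Γ)) =
      edgeStab Γ G (g u) (g v) := by
  ext k
  refine Subgroup.mem_map_equiv.trans ?_
  rw [MulAut.conj_symm_apply, mem_edgeStab, mem_edgeStab]
  have h : ∀ w, (g⁻¹ * k * g) w = w ↔ k (g w) = g w := fun w => by
    rw [RelIso.mul_apply, RelIso.mul_apply]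
    constructor
    · intro h
      have h' := congrArg g h
      rwa [RelIso.apply_inv_self] at h'
    · intro h
      rw [h, RelIso.inv_apply_self]
  rw [h, h, Subgroup.mul_mem_cancel_right _ hg, Subgroup.mul_mem_cancel_left _ (inv_mem hg)]

theorem IsLocallyTransitive.nonempty_edgeStab_mulEquiv (h : IsLocallyTransitive Γ G)
    (hΓ : Γ.Connected) {u v a b : V} (huv : Γ.Adj u v) (hab : Γ.Adj a b) :
    Nonempty (edgeStab Γ G u v ≃* edgeStab Γ G a b) := by
  obtain ⟨g, hg, ⟨rfl, rfl⟩ | ⟨rfl, rfl⟩⟩ := h.exists_map_edge hΓ huv hab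
  · rw [← edgeStab_map_conj hg]
    exact ⟨Subgroup.equivMapOfInjective _ _ (MulAut.conj g).injective⟩
  · rw [edgeStab_comm (g v), ← edgeStab_map_conj hg]
    exact ⟨Subgroup.equivMapOfInjective _ _ (MulAut.conj g).injective⟩

/-- The index of `G_uv` in `G_u` is the valency of `u`. -/
theorem IsLocallyTransitive.finite_vertexStab (h : IsLocallyTransitive Γ G) {u v : V}
    (huv : Γ.Adj u v) (hfin : (Γ.neighborSet u).Finite) (hB : Finite (edgeStab Γ G u v)) :
    Finite (vertexStab Γ G u) := by
  let C := (edgeStab Γ G u v).subgroupOf (vertexStab Γ G u)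
  have e := quotientEquivNeighborSet (C := C) (vertexStab Γ G u).subtype huv (fun p => p.2.2)
    (fun p => ⟨fun hp => hp.2.2, fun hp => ⟨p.2, p.2.1, hp⟩⟩)
    (fun w hw => (h.exists_mem_adj huv w hw).elim fun g hg => ⟨⟨g, hg.1⟩, hg.2⟩)
  have : Finite (Γ.neighborSet u) := hfin
  have : Finite (vertexStab Γ G u ⧸ C) := Finite.of_equiv _ e.symm
  have : Finite C := @Finite.of_equiv _ _ hB
    (Subgroup.subgroupOfEquivOfLe (inf_le_left : edgeStab Γ G u v ≤ _)).symm.toEquiv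
  exact Finite.of_equiv _ (Subgroup.groupEquivQuotientProdSubgroup (s := C)).symm

end LocalAction

/-! ### The amalgam of an edge. -/

namespace Amalgam

section OfSubgroups

variable {X : Type*} [Group X] {k : ℕ} (S : Fin k → Subgroup X)

/-- The members of a family of subgroups, as subsets of the union of the family. -/
def unionPart (i : Fin k) : Set {x : X // ∃ i, x ∈ S i} := {x | (x : X) ∈ S i}

/-- A member of a family of subgroups is in bijection with its copy in the union of the family. -/
def unionPartEquiv (i : Fin k) : unionPart S i ≃ S i where
  toFun x := ⟨x.1.1, x.2⟩
  invFun x := ⟨⟨x, i, x.2⟩, x.2⟩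
  left_inv _ := rfl
  right_inv _ := rfl

/-- The amalgam formed by finite subgroups of a group. -/
def ofSubgroups (hk : 0 < k) (hS : ∀ i, Finite (S i)) :
    Amalgam k {x : X // ∃ i, x ∈ S i} where
  finite := (Set.finite_iUnion (fun i => Set.toFinite (S i : Set X))).to_subtype.of_injective
    (fun x => (⟨x.1, Set.mem_iUnion.2 x.2⟩ : ⋃ i, (S i : Set X)))
    (fun _ _ h => Subtype.ext (Subtype.mk.inj h))
  P := unionPart S
  group i := (unionPartEquiv S i).group
  iUnion_eq := Set.eq_univ_of_forall fun x => Set.mem_iUnion.2 x.2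
  iInter_nonempty := ⟨⟨1, ⟨0, hk⟩, one_mem _⟩, Set.mem_iInter.2 fun i => (S i).one_mem⟩
  mul_compat _ _ _ _ _ _ _ _ := rfl

variable {S} (hk : 0 < k) (hS : ∀ i, Finite (S i))

/-- The inclusion of a member of an amalgam of subgroups. -/
def ofSubgroupsIncl (i : Fin k) : (ofSubgroups S hk hS).P i →* X where
  toFun x := x.1.1
  map_one' := rfl
  map_mul' _ _ := rfl

theorem ofSubgroupsIncl_injective (i : Fin k) :
    Function.Injective (ofSubgroupsIncl hk hS i) :=
  fun _ _ h => Subtype.ext (Subtype.ext h)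

theorem ofSubgroupsIncl_range (i : Fin k) : (ofSubgroupsIncl hk hS i).range = S i := by
  ext x
  exact ⟨fun ⟨y, hy⟩ => hy ▸ y.2, fun hx => ⟨⟨⟨x, i, hx⟩, hx⟩, rfl⟩⟩

theorem mem_borel_ofSubgroups {i : Fin k} {x : (ofSubgroups S hk hS).P i} :
    x ∈ (ofSubgroups S hk hS).borel i ↔ ∀ j, x.1.1 ∈ S j := Set.mem_iInter

theorem map_borel_ofSubgroups (i : Fin k) :
    ((ofSubgroups S hk hS).borel i).map (ofSubgroupsIncl hk hS i) = ⨅ j, S j := by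
  ext x
  rw [Subgroup.mem_iInf]
  constructor
  · rintro ⟨y, hy, rfl⟩
    exact (mem_borel_ofSubgroups hk hS).1 hy
  · intro hx
    exact ⟨⟨⟨x, i, hx i⟩, hx i⟩, (mem_borel_ofSubgroups hk hS).2 hx, rfl⟩

end OfSubgroups

section OfEdge

variable {V : Type*} {Γ : SimpleGraph V} {G : Subgroup (Γ ≃g Γ)} {u v : V}

/-- The normaliser of the given subgroup contains `G_u` and `G_v`, so it moves the edge `uv` onto
every vertex; conjugates of an element that stay in the subgroup fix `u` and `v`, hence the element
fixes every vertex. -/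
theorem faithful_of_edge (hΓ : Γ.Connected) (hG : IsLocallyTransitive Γ G) (huv : Γ.Adj u v)
    (hS : ∀ i, Finite ((![vertexStab Γ G u, vertexStab Γ G v] : Fin 2 → _) i)) :
    (ofSubgroups ![vertexStab Γ G u, vertexStab Γ G v] two_pos hS).Faithful := by
  intro N hN hM
  choose M hM hMN using hM
  have hval : ∀ i, (fun a : {x : Γ ≃g Γ // ∃ i, x ∈ (![vertexStab Γ G u, vertexStab Γ G v] :
      Fin 2 → _) i} => (a : Γ ≃g Γ)) '' N =
      ((M i).map (ofSubgroupsIncl two_pos hS i) : Set (Γ ≃g Γ)) := by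
    intro i
    rw [← hMN i, Set.image_image, Subgroup.coe_map]
    rfl
  let N' := (M 0).map (ofSubgroupsIncl two_pos hS 0)
  -- Both `M i` have the same underlying set `N`, so they give one subgroup of the automorphism
  -- group.
  have hN' : ∀ i, N' = (M i).map (ofSubgroupsIncl two_pos hS i) := fun i =>
    SetLike.coe_injective ((hval 0).symm.trans (hval i))
  have hnorm : ∀ i, (![vertexStab Γ G u, vertexStab Γ G v] : Fin 2 → _) i ≤
      Subgroup.normalizer (N' : Set (Γ ≃g Γ)) := by
    intro i
    have hMi := hM i
    rw [hN' i, ← ofSubgroupsIncl_range two_pos hS i, MonoidHom.range_eq_map,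
      ← Subgroup.normalizer_eq_top (H := M i)]
    exact Subgroup.le_normalizer_map _
  have hfix : ∀ n ∈ N', n u = u ∧ n v = v := by
    rintro _ ⟨n, hn, rfl⟩
    have hnN : n.1 ∈ N := by
      rw [← hMN 0]
      exact ⟨n, hn, rfl⟩
    have h := Set.mem_iInter.1 (hN hnN)
    exact ⟨(h 0 : _ ∈ vertexStab Γ G u).2, (h 1 : _ ∈ vertexStab Γ G v).2⟩
  have htriv : ∀ n ∈ N', n = 1 := by
    intro n hn
    ext x
    obtain ⟨k, hk, hx⟩ := exists_mem_eq_or_eq (K := Subgroup.normalizer (N' : Set (Γ ≃g Γ)))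
      hΓ
      (fun x hx => (hG.exists_mem_adj huv x hx).imp fun g hg => ⟨hnorm 0 hg.1, hg.1.2, hg.2⟩)
      (fun x hx => (hG.exists_mem_adj huv.symm x hx).imp
        fun g hg => ⟨hnorm 1 hg.1, hg.1.2, hg.2⟩) x
    have h := hfix (k⁻¹ * n * k) (by
      simpa using (Subgroup.mem_normalizer_iff.1 (inv_mem hk) n).1 hn)
    have hcancel : ∀ w, (k⁻¹ * n * k) w = w → n (k w) = k w := fun w hw => by
      rw [RelIso.mul_apply, RelIso.mul_apply] at hw
      have h' := congrArg k hw
      rwa [RelIso.apply_inv_self] at h'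
    obtain rfl | rfl := hx
    · exact hcancel _ h.1
    · exact hcancel _ h.2
  intro a ha b hb
  have h : ∀ a ∈ N, (a : Γ ≃g Γ) = 1 := fun a ha => htriv a (by
    have : (a : Γ ≃g Γ) ∈ (N' : Set (Γ ≃g Γ)) := by
      rw [← hval 0]
      exact ⟨a, ha, rfl⟩
    exact this)
  exact Subtype.ext ((h a ha).trans (h b hb).symm)

end OfEdge

end Amalgam

/-- The stabilisers of the ends of an edge form a faithful amalgam. -/
theorem IsLocallyPair.exists_amalgam {V : Type} {Γ : SimpleGraph V} {G : Subgroup (Γ ≃g Γ)}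
    {Ω₁ Ω₂ B : Type*} [Group B] [Finite B] {L₁ : Subgroup (Equiv.Perm Ω₁)}
    {L₂ : Subgroup (Equiv.Perm Ω₂)} (h : IsLocallyPair Γ G L₁ L₂) {a b : V} (hab : Γ.Adj a b)
    (hB : Nonempty (edgeStab Γ G a b ≃* B)) :
    ∃ (A : Type) (𝒜 : Amalgam 2 A), 𝒜.Faithful ∧ 𝒜.HasPermType L₁ L₂ ∧ 𝒜.HasBorel B := by
  obtain ⟨u, v, huv, h₁, h₂⟩ := h.exists_edge
  have ht := h.locallyTransitive
  obtain ⟨eB⟩ := hB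
  -- The edge exhibiting the local groups need not be the one exhibiting `B`; edge-transitivity
  -- makes their stabilisers isomorphic.
  obtain ⟨e⟩ := ht.nonempty_edgeStab_mulEquiv h.connected huv hab
  have hfin : Finite (edgeStab Γ G u v) := Finite.of_equiv _ (e.trans eB).symm.toEquiv
  have hS : ∀ i, Finite ((![vertexStab Γ G u, vertexStab Γ G v] : Fin 2 → _) i) := by
    rw [Fin.forall_fin_two]
    exact ⟨ht.finite_vertexStab huv (h.locallyFinite u) hfin,
      ht.finite_vertexStab huv.symm (h.locallyFinite v) (edgeStab_comm (G := G) u v ▸ hfin)⟩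
  refine ⟨_, Amalgam.ofSubgroups ![vertexStab Γ G u, vertexStab Γ G v] two_pos hS,
    Amalgam.faithful_of_edge h.connected ht huv hS, Or.inl ⟨?_, ?_⟩, fun i => ?_⟩
  · refine PermIso.trans (permIso_cosets_localGroup (Amalgam.ofSubgroupsIncl two_pos hS 0) huv
      (Amalgam.ofSubgroupsIncl_range two_pos hS 0) (fun p => ?_) fun w hw => ?_) h₁
    · rw [Amalgam.mem_borel_ofSubgroups, Fin.forall_fin_two]
      exact ⟨fun hp => hp.2.2, fun hp => ⟨p.2, (p.2 : _ ∈ vertexStab Γ G u).1, hp⟩⟩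
    · obtain ⟨g, hg, hw⟩ := ht.exists_mem_adj huv w hw
      exact ⟨⟨⟨g, 0, hg⟩, hg⟩, hw⟩
  · refine PermIso.trans (permIso_cosets_localGroup (Amalgam.ofSubgroupsIncl two_pos hS 1)
      huv.symm (Amalgam.ofSubgroupsIncl_range two_pos hS 1) (fun p => ?_) fun w hw => ?_) h₂
    · rw [Amalgam.mem_borel_ofSubgroups, Fin.forall_fin_two]
      exact ⟨fun hp => hp.1.2, fun hp => ⟨⟨(p.2 : _ ∈ vertexStab Γ G v).1, hp⟩, p.2⟩⟩
    · obtain ⟨g, hg, hw⟩ := ht.exists_mem_adj huv.symm w hw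
      exact ⟨⟨⟨g, 1, hg⟩, hg⟩, hw⟩
  · have hr : (⨅ j, (![vertexStab Γ G u, vertexStab Γ G v] : Fin 2 → _) j) =
        edgeStab Γ G u v := by
      ext x
      rw [Subgroup.mem_iInf, Fin.forall_fin_two]
      rfl
    exact ⟨((Subgroup.equivMapOfInjective _ _
      (Amalgam.ofSubgroupsIncl_injective two_pos hS i)).trans
      (MulEquiv.subgroupCongr ((Amalgam.map_borel_ofSubgroups two_pos hS i).trans hr))).trans
      (e.trans eB)⟩

/-! ### Coset graphs. -/

section CosetGraph

variable {ι Q : Type*} [Group Q] (S : ι → Subgroup Q)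

/-- The coset graph of a family of subgroups: cosets of distinct members of the family are adjacent
when they have a common element. -/
def cosetGraph : SimpleGraph (Σ i, Q ⧸ S i) where
  Adj x y := x.1 ≠ y.1 ∧ ∃ g : Q, x.2 = g ∧ y.2 = g
  symm := ⟨fun _ _ ⟨h, g, hx, hy⟩ => ⟨h.symm, g, hy, hx⟩⟩
  loopless := ⟨fun _ h => h.1 rfl⟩

/-- The vertex of the coset graph given by the coset `g S i`. -/
def cosetVertex (i : ι) (g : Q) : Σ i, Q ⧸ S i := ⟨i, g⟩

theorem cosetVertex_eq_iff {i : ι} {g h : Q} :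
    cosetVertex S i g = cosetVertex S i h ↔ g⁻¹ * h ∈ S i := by
  rw [← QuotientGroup.eq]
  exact ⟨fun e => eq_of_heq (Sigma.mk.inj e).2, fun e => congrArg (Sigma.mk i) e⟩

theorem exists_eq_cosetVertex (x : Σ i, Q ⧸ S i) : ∃ g, x = cosetVertex S x.1 g := by
  obtain ⟨i, x⟩ := x
  induction x using QuotientGroup.induction_on with | _ g => exact ⟨g, rfl⟩

theorem cosetGraph_adj_cosetVertex {i j : ι} (h : i ≠ j) (g : Q) :
    (cosetGraph S).Adj (cosetVertex S i g) (cosetVertex S j g) := ⟨h, g, rfl, rfl⟩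

theorem cosetGraph_adj_iff {x y : Σ i, Q ⧸ S i} : (cosetGraph S).Adj x y ↔
    x.1 ≠ y.1 ∧ ∃ g : Q, x = cosetVertex S x.1 g ∧ y = cosetVertex S y.1 g := by
  obtain ⟨i, x⟩ := x
  obtain ⟨j, y⟩ := y
  refine and_congr_right fun _ => exists_congr fun g => and_congr ?_ ?_
  · exact ⟨fun e => congrArg (Sigma.mk i) e, fun e => eq_of_heq (Sigma.mk.inj e).2⟩
  · exact ⟨fun e => congrArg (Sigma.mk j) e, fun e => eq_of_heq (Sigma.mk.inj e).2⟩

theorem cosetGraph_smul_adj (q : Q) {x y : Σ i, Q ⧸ S i} (h : (cosetGraph S).Adj x y) :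
    (cosetGraph S).Adj (q • x) (q • y) := by
  obtain ⟨h, g, hx, hy⟩ := h
  exact ⟨h, q * g, congrArg (q • ·) hx, congrArg (q • ·) hy⟩

/-- The action of the group on the coset graph by left multiplication. -/
def cosetGraphAction : Q →* (cosetGraph S ≃g cosetGraph S) where
  toFun q := ⟨MulAction.toPerm q, fun {x y} =>
    ⟨fun h => by
      have h' := cosetGraph_smul_adj S q⁻¹ h
      simpa using h', cosetGraph_smul_adj S q⟩⟩
  map_one' := RelIso.ext fun x => one_smul Q x
  map_mul' p q := RelIso.ext fun x => mul_smul p q x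

theorem cosetGraphAction_cosetVertex (q : Q) (i : ι) (g : Q) :
    cosetGraphAction S q (cosetVertex S i g) = cosetVertex S i (q * g) := rfl

theorem cosetGraphAction_cosetVertex_one_eq_iff {q : Q} {i : ι} :
    cosetGraphAction S q (cosetVertex S i 1) = cosetVertex S i 1 ↔ q ∈ S i := by
  rw [cosetGraphAction_cosetVertex, cosetVertex_eq_iff, mul_one, mul_one, inv_mem_iff]

theorem mem_of_cosetGraphAction_eq_one {q : Q} (h : cosetGraphAction S q = 1) (i : ι) :
    q ∈ S i := by
  rw [← cosetGraphAction_cosetVertex_one_eq_iff, h]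
  rfl

/-- Each edge consists of the cosets of a single element. With only two types, the neighbours `y`
and `z` have the same type, so `h * g⁻¹` carries the edge of `g` to the edge of `h`. -/
theorem cosetGraph_exists_smul_of_adj {S : Fin 2 → Subgroup Q} {x y z : Σ i, Q ⧸ S i}
    (hy : (cosetGraph S).Adj x y) (hz : (cosetGraph S).Adj x z) :
    ∃ q : Q, cosetGraphAction S q x = x ∧ cosetGraphAction S q y = z := by
  rw [cosetGraph_adj_iff] at hy hz
  obtain ⟨hxy, g, hxg, hyg⟩ := hy
  obtain ⟨hxz, h, hxh, hzh⟩ := hz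
  have hyz : y.1 = z.1 := by omega
  refine ⟨h * g⁻¹, ?_, ?_⟩
  · conv_lhs => rw [hxg]
    rw [cosetGraphAction_cosetVertex, inv_mul_cancel_right, ← hxh]
  · conv_lhs => rw [hyg]
    rw [cosetGraphAction_cosetVertex, inv_mul_cancel_right, hyz, ← hzh]

theorem cosetGraph_isLocallyTransitive (S : Fin 2 → Subgroup Q) :
    IsLocallyTransitive (cosetGraph S) (cosetGraphAction S).range := fun v => by
  rw [isPretransitive_localGroup_iff]
  intro x y hx hy
  obtain ⟨q, hq, hq'⟩ := cosetGraph_exists_smul_of_adj hx hy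
  exact ⟨cosetGraphAction S q, ⟨⟨q, rfl⟩, hq⟩, hq'⟩

/-- The neighbours of `g S i` are among the cosets `g s S j` with `s` in `S i`. -/
theorem cosetGraph_finite_neighborSet [Finite ι] (hS : ∀ i, Finite (S i)) (v : Σ i, Q ⧸ S i) :
    ((cosetGraph S).neighborSet v).Finite := by
  obtain ⟨g, hg⟩ := exists_eq_cosetVertex S v
  have := hS v.1
  refine (Set.finite_range fun p : ι × S v.1 => cosetVertex S p.1 (g * p.2)).subset fun w hw => ?_
  obtain ⟨-, h, hv, hw⟩ := (cosetGraph_adj_iff S).1 hw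
  rw [hg] at hv
  exact ⟨⟨w.1, ⟨g⁻¹ * h, (cosetVertex_eq_iff S).1 hv⟩⟩, by simp [← hw]⟩

/-- The elements that move the base vertex within its component form a subgroup. It contains each `S
i`, which fixes a vertex reachable from the base vertex. -/
theorem cosetGraph_connected [Nontrivial ι] (hS : ⨆ i, S i = ⊤) : (cosetGraph S).Connected := by
  obtain ⟨i₀⟩ := (inferInstance : Nonempty ι)
  let o := cosetVertex S i₀ 1
  have hmap : ∀ (q : Q) x y, (cosetGraph S).Reachable x y →
      (cosetGraph S).Reachable (cosetGraphAction S q x) (cosetGraphAction S q y) :=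
    fun q x y h => h.map (cosetGraphAction S q).toHom
  have hbase : ∀ i g, (cosetGraph S).Reachable (cosetVertex S i₀ g) (cosetVertex S i g) := by
    intro i g
    by_cases h : i₀ = i
    · subst h
      exact SimpleGraph.Reachable.refl _
    · exact (cosetGraph_adj_cosetVertex S h g).reachable
  let R : Subgroup Q :=
    { carrier := {q | (cosetGraph S).Reachable o (cosetGraphAction S q o)}
      one_mem' := by
        change (cosetGraph S).Reachable _ _
        rw [map_one]
        exact SimpleGraph.Reachable.refl _
      mul_mem' := fun {a b} ha hb => by
        have h := SimpleGraph.Reachable.trans ha (hmap a _ _ hb)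
        rw [← RelIso.mul_apply, ← map_mul] at h
        exact h
      inv_mem' := fun {a} ha => by
        have h := (hmap a⁻¹ _ _ ha).symm
        rw [← RelIso.mul_apply, ← map_mul, inv_mul_cancel, map_one] at h
        exact h }
  have hR : ∀ q, q ∈ R := by
    have : R = ⊤ := by
      rw [eq_top_iff, ← hS, iSup_le_iff]
      intro i p hp
      have h := hmap p _ _ (hbase i 1)
      rw [(cosetGraphAction_cosetVertex_one_eq_iff S).2 hp] at h
      exact (hbase i 1).trans h.symm
    rw [this]
    exact fun _ => Subgroup.mem_top _
  have ho : ∀ x, (cosetGraph S).Reachable o x := by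
    intro x
    obtain ⟨g, hg⟩ := exists_eq_cosetVertex S x
    rw [hg]
    have h := hR g
    change (cosetGraph S).Reachable _ (cosetGraphAction S g (cosetVertex S i₀ 1)) at h
    rw [cosetGraphAction_cosetVertex, mul_one] at h
    exact h.trans (hbase _ _)
  have : Nonempty (Σ i, Q ⧸ S i) := ⟨o⟩
  exact ⟨fun x y => (ho x).symm.trans (ho y)⟩

end CosetGraph

/-! ### Completions of an amalgam and their coset graphs. -/

namespace Amalgam

variable {k : ℕ} {A : Type*} {𝒜 : Amalgam k A} {Q : Type*} [Group Q]

/-- A completion of an amalgam in which the images of distinct members of the amalgam meet in the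
image of the Borel subgroup. -/
structure IsCompletion (𝒜 : Amalgam k A) (f : ∀ i, 𝒜.P i →* Q) : Prop where
  injective : ∀ i, Function.Injective (f i)
  compat : ∀ i j (x : A) (hi : x ∈ 𝒜.P i) (hj : x ∈ 𝒜.P j), f i ⟨x, hi⟩ = f j ⟨x, hj⟩
  mem_borel : ∀ i j, i ≠ j → ∀ p q, f i p = f j q → p ∈ 𝒜.borel i
  iSup_range : ⨆ i, (f i).range = ⊤

namespace IsCompletion

theorem mem_borel_iff {f : ∀ i, 𝒜.P i →* Q} (hf : 𝒜.IsCompletion f) {i j : Fin k}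
    (hij : i ≠ j) (p : 𝒜.P i) : p ∈ 𝒜.borel i ↔ f i p ∈ (f j).range := by
  constructor
  · intro hp
    exact ⟨⟨p, Set.mem_iInter.1 hp j⟩, hf.compat j i p _ p.2⟩
  · rintro ⟨q, hq⟩
    exact hf.mem_borel i j hij p q hq.symm

theorem exists_borel {𝒜 : Amalgam 2 A} {f : ∀ i, 𝒜.P i →* Q} (hf : 𝒜.IsCompletion f) {q : Q}
    (hq : ∀ i, q ∈ (f i).range) : ∃ a : A, a ∈ ⋂ i, 𝒜.P i ∧ ∀ i h, f i ⟨a, h⟩ = q := by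
  obtain ⟨p, rfl⟩ := hq 0
  exact ⟨p, (hf.mem_borel_iff zero_ne_one p).2 (hq 1), fun i h => hf.compat i 0 p h p.2⟩

variable {𝒜 : Amalgam 2 A} {f : ∀ i, 𝒜.P i →* Q} (hf : 𝒜.IsCompletion f)

include hf

/-- The kernel fixes both base vertices, so it lies in the image of the Borel subgroup; it pulls
back to a normal subgroup of each `P i`, with the same underlying set, which faithfulness makes
trivial. -/
theorem cosetGraphAction_injective (h𝒜 : 𝒜.Faithful) :
    Function.Injective (cosetGraphAction fun i => (f i).range) := by
  rw [injective_iff_map_eq_one]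
  let K := (cosetGraphAction fun i => (f i).range).ker
  have hK : ∀ q ∈ K, ∀ i, q ∈ (f i).range := fun q hq i => mem_of_cosetGraphAction_eq_one _ hq i
  have hsub := h𝒜 {a | a ∈ ⋂ i, 𝒜.P i ∧ ∀ i h, f i ⟨a, h⟩ ∈ K} (fun a ha => ha.1) fun i => by
    refine ⟨K.comap (f i), inferInstance, Set.ext fun a => ?_⟩
    constructor
    · rintro ⟨p, hp, rfl⟩
      have hp : f i p ∈ K := hp
      obtain ⟨a, ha, hq⟩ := hf.exists_borel (hK _ hp)
      have hpa : p = ⟨a, Set.mem_iInter.1 ha i⟩ := hf.injective i (hq i _).symm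
      subst hpa
      exact ⟨ha, fun j h => by rw [hq]; exact hp⟩
    · rintro ⟨ha, h⟩
      exact ⟨⟨a, Set.mem_iInter.1 ha i⟩, h i _, rfl⟩
  intro q hq
  obtain ⟨a, ha, haq⟩ := hf.exists_borel (hK q hq)
  obtain ⟨b, hb, hb1⟩ := hf.exists_borel (q := 1) fun i => one_mem _
  have hab : a = b := hsub ⟨ha, fun i h => by rw [haq]; exact hq⟩
    ⟨hb, fun i h => by rw [hb1]; exact one_mem _⟩
  subst hab
  rw [← haq 0 (Set.mem_iInter.1 ha 0), hb1]

/-- The stabiliser of the coset `P i` is the image of `P i`, and the elements of `P i` fixing the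
adjacent coset `P j` are those of the Borel subgroup. -/
theorem permIso_localGroup {i j : Fin 2} (hij : i ≠ j) :
    PermIso (𝒜.cosetGroup i)
      (localGroup (cosetGraph fun i => (f i).range) (cosetGraphAction fun i => (f i).range).range
        (cosetVertex _ i 1)) := by
  refine permIso_cosets_localGroup ((cosetGraphAction fun i => (f i).range).comp (f i))
    (cosetGraph_adj_cosetVertex _ hij 1) ?_ ?_ ?_
  · ext g
    constructor
    · rintro ⟨p, rfl⟩
      exact ⟨⟨_, rfl⟩, (cosetGraphAction_cosetVertex_one_eq_iff _).2 ⟨p, rfl⟩⟩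
    · rintro ⟨⟨q, rfl⟩, hq⟩
      obtain ⟨p, rfl⟩ := (cosetGraphAction_cosetVertex_one_eq_iff _).1 hq
      exact ⟨p, rfl⟩
  · intro p
    rw [MonoidHom.comp_apply, cosetGraphAction_cosetVertex_one_eq_iff, hf.mem_borel_iff hij]
  · intro w hw
    obtain ⟨hne, g, hi, hw⟩ := (cosetGraph_adj_iff _).1 hw
    have hwj : w.1 = j := by
      have : i ≠ w.1 := hne
      omega
    obtain ⟨p, hp⟩ := (cosetVertex_eq_iff _).1 hi
    refine ⟨p, ?_⟩
    rw [hw, hwj, MonoidHom.comp_apply, hp, cosetGraphAction_cosetVertex]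
    simp

theorem nonempty_edgeStab_mulEquiv (h𝒜 : 𝒜.Faithful) :
    Nonempty (𝒜.borel 0 ≃* edgeStab (cosetGraph fun i => (f i).range)
      (cosetGraphAction fun i => (f i).range).range (cosetVertex _ 0 1) (cosetVertex _ 1 1)) := by
  have h : (𝒜.borel 0).map ((cosetGraphAction fun i => (f i).range).comp (f 0)) =
      edgeStab (cosetGraph fun i => (f i).range) (cosetGraphAction fun i => (f i).range).range
        (cosetVertex _ 0 1) (cosetVertex _ 1 1) := by
    ext g
    rw [mem_edgeStab]
    constructor
    · rintro ⟨p, hp, rfl⟩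
      refine ⟨⟨_, rfl⟩, (cosetGraphAction_cosetVertex_one_eq_iff _).2 ⟨p, rfl⟩,
        (cosetGraphAction_cosetVertex_one_eq_iff _).2 ((hf.mem_borel_iff zero_ne_one p).1 hp)⟩
    · rintro ⟨⟨q, rfl⟩, h0, h1⟩
      obtain ⟨p, rfl⟩ := (cosetGraphAction_cosetVertex_one_eq_iff _).1 h0
      exact ⟨p, (hf.mem_borel_iff zero_ne_one p).2
        ((cosetGraphAction_cosetVertex_one_eq_iff fun i => (f i).range).1 h1), rfl⟩
  rw [← h]
  exact ⟨Subgroup.equivMapOfInjective _ _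
    ((hf.cosetGraphAction_injective h𝒜).comp (hf.injective 0))⟩

theorem isLocallyPair {Ω₁ Ω₂ : Type*} {L₁ : Subgroup (Equiv.Perm Ω₁)}
    {L₂ : Subgroup (Equiv.Perm Ω₂)} (hL : 𝒜.HasPermType L₁ L₂) :
    IsLocallyPair (cosetGraph fun i => (f i).range) (cosetGraphAction fun i => (f i).range).range
      L₁ L₂ where
  connected := cosetGraph_connected _ hf.iSup_range
  locallyFinite := cosetGraph_finite_neighborSet _ fun i => by
    have := 𝒜.finite
    exact Set.finite_range (f i)
  locallyTransitive := cosetGraph_isLocallyTransitive _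
  exists_edge := by
    have h0 := (hf.permIso_localGroup zero_ne_one).symm
    have h1 := (hf.permIso_localGroup one_ne_zero).symm
    obtain ⟨hL₁, hL₂⟩ | ⟨hL₂, hL₁⟩ := hL
    · exact ⟨_, _, cosetGraph_adj_cosetVertex _ zero_ne_one 1, h0.trans hL₁, h1.trans hL₂⟩
    · exact ⟨_, _, cosetGraph_adj_cosetVertex _ one_ne_zero 1, h1.trans hL₁, h0.trans hL₂⟩

end IsCompletion

end Amalgam

/-! ### Finite permutation representations of amalgamated products. -/

section TransversalAction

variable {ι H : Type*} {G T : ι → Type*} [DecidableEq ι] [∀ i, Group (G i)]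

/-- Given bijections of the groups `G i` with `H × T i`, the group `G i` acts on the first factor of
`H × Π i, T i` and the factor `T i`. -/
def transversalSMul (d : ∀ i, G i ≃ H × T i) (i : ι) (g : G i) (x : H × ∀ j, T j) :
    H × ∀ j, T j :=
  ((d i (g * (d i).symm (x.1, x.2 i))).1,
    Function.update x.2 i (d i (g * (d i).symm (x.1, x.2 i))).2)

theorem one_transversalSMul (d : ∀ i, G i ≃ H × T i) (i : ι) (x : H × ∀ j, T j) :
    transversalSMul d i 1 x = x := by
  simp [transversalSMul]

theorem mul_transversalSMul (d : ∀ i, G i ≃ H × T i) (i : ι) (g h : G i) (x : H × ∀ j, T j) :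
    transversalSMul d i (g * h) x = transversalSMul d i g (transversalSMul d i h x) := by
  simp [transversalSMul, mul_assoc]

/-- The action of `G i` on `H × Π i, T i`, as a homomorphism. -/
def transversalAction (d : ∀ i, G i ≃ H × T i) (i : ι) :
    G i →* Equiv.Perm (H × ∀ j, T j) where
  toFun g :=
    { toFun := transversalSMul d i g
      invFun := transversalSMul d i g⁻¹
      left_inv := fun x => by
        rw [← mul_transversalSMul, inv_mul_cancel, one_transversalSMul]
      right_inv := fun x => by
        rw [← mul_transversalSMul, mul_inv_cancel, one_transversalSMul] }
  map_one' := Equiv.ext (one_transversalSMul d i)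
  map_mul' g h := Equiv.ext (mul_transversalSMul d i g h)

variable {d : ∀ i, G i ≃ H × T i}

theorem transversalAction_apply (i : ι) (g : G i) (x : H × ∀ j, T j) :
    transversalAction d i g x = ((d i (g * (d i).symm (x.1, x.2 i))).1,
      Function.update x.2 i (d i (g * (d i).symm (x.1, x.2 i))).2) := rfl

theorem transversalAction_injective [Nonempty H] (t : ∀ j, T j) (i : ι) :
    Function.Injective (transversalAction d i) := by
  intro g h hgh
  obtain ⟨x⟩ := ‹Nonempty H›
  have h1 := congrArg (fun σ => σ (x, t)) hgh
  simp only [transversalAction_apply, Prod.mk.injEq] at h1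
  have h2 := congrFun h1.2 i
  rw [Function.update_self, Function.update_self] at h2
  exact mul_right_cancel ((d i).injective (Prod.ext h1.1 h2))

variable [Group H] {φ : ∀ i, H →* G i}
  (hd : ∀ i h g, d i (φ i h * g) = (h * (d i g).1, (d i g).2))

include hd

/-- The result does not depend on `i`: the actions of the factors agree on `H` and therefore glue to
the amalgamated product. -/
theorem transversalAction_map (i : ι) (h : H) (x : H × ∀ j, T j) :
    transversalAction d i (φ i h) x = (h * x.1, x.2) := by
  rw [transversalAction_apply, hd, Equiv.apply_symm_apply, Function.update_eq_self]

/-- The group `G j` never changes the coordinate in `T i`. So `g` preserves the `T i`-part of `z`,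
that is, `g * z` and `z` lie in the same right coset of `H`. -/
theorem mem_range_of_transversalAction_eq (t : ∀ j, T j) {i j : ι} (hij : i ≠ j) {g : G i}
    {g' : G j} (h : transversalAction d i g = transversalAction d j g') : g ∈ (φ i).range := by
  have h1 := congrArg (fun σ => (σ (1, t)).2 i) h
  simp only [transversalAction_apply] at h1
  rw [Function.update_self, Function.update_of_ne hij] at h1
  set z := (d i).symm (1, t i) with hz
  have hdz : d i z = (1, t i) := by rw [hz, Equiv.apply_symm_apply]
  refine ⟨(d i (g * z)).1, mul_right_cancel (b := z) ((d i).injective ?_)⟩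
  rw [hd, hdz, mul_one]
  exact Prod.ext rfl h1.symm

end TransversalAction

theorem exists_transversal_equiv {H G : Type} [Group H] [Group G] {φ : H →* G}
    (hφ : Function.Injective φ) : ∃ (T : Type) (_ : Nonempty T) (d : G ≃ H × T),
      ∀ h g, d (φ h * g) = (h * (d g).1, (d g).2) := by
  -- The transversal is made to contain `1` only so that it is visibly nonempty.
  obtain ⟨T, hT, h1⟩ := φ.range.exists_isComplement_right 1
  let e := φ.ofInjective hφ
  refine ⟨T, ⟨⟨1, h1⟩⟩, hT.equiv.trans (Equiv.prodCongr e.symm.toEquiv (Equiv.refl _)),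
    fun h g => ?_⟩
  have h2 := hT.equiv_mul_left (e h) g
  have h3 : ((e h : φ.range) : G) = φ h := rfl
  rw [h3] at h2
  change (e.symm (hT.equiv (φ h * g)).1, (hT.equiv (φ h * g)).2) =
    (h * e.symm (hT.equiv g).1, (hT.equiv g).2)
  rw [h2, map_mul, MulEquiv.symm_apply_apply]

/-- An amalgamated product of finite groups has a finite permutation representation in which the
factors act faithfully and the images of distinct factors meet in the image of the base. -/
theorem exists_finite_permRep {ι H : Type} {G : ι → Type} [Finite ι] [Nonempty ι] [Group H]
    [Finite H] [∀ i, Group (G i)] [∀ i, Finite (G i)] {φ : ∀ i, H →* G i}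
    (hφ : ∀ i, Function.Injective (φ i)) :
    ∃ (X : Type) (_ : Finite X) (θ : Monoid.PushoutI φ →* Equiv.Perm X),
      (∀ i, Function.Injective fun g => θ (Monoid.PushoutI.of i g)) ∧
      ∀ i j, i ≠ j → ∀ g g', θ (Monoid.PushoutI.of i g) = θ (Monoid.PushoutI.of j g') →
        g ∈ (φ i).range := by
  classical
  choose T hT d hd using fun i => exists_transversal_equiv (hφ i)
  let t : ∀ i, T i := fun i => (hT i).some
  have : ∀ i, Finite (T i) := fun i =>
    Finite.of_surjective (fun p => (d i p).2) (Prod.snd_surjective.comp (d i).surjective)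
  obtain ⟨i₀⟩ := ‹Nonempty ι›
  let θ : Monoid.PushoutI φ →* Equiv.Perm (H × ∀ i, T i) :=
    Monoid.PushoutI.lift (transversalAction d) ((transversalAction d i₀).comp (φ i₀)) fun i => by
      ext1 b
      refine Equiv.ext fun x => ?_
      rw [MonoidHom.comp_apply, MonoidHom.comp_apply, transversalAction_map hd,
        transversalAction_map hd]
  have hθ : ∀ i g, θ (Monoid.PushoutI.of i g) = transversalAction d i g :=
    fun i g => Monoid.PushoutI.lift_of _ _ _ g
  refine ⟨_, inferInstance, θ, fun i g h hgh => ?_, fun i j hij g g' h => ?_⟩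
  · exact transversalAction_injective t i ((hθ i g).symm.trans (hgh.trans (hθ i h)))
  · exact mem_range_of_transversalAction_eq hd t hij ((hθ i g).symm.trans (h.trans (hθ j g')))

/-! ### The universal completion and a finite completion. -/

namespace Amalgam

open Monoid

variable {A : Type*} (𝒜 : Amalgam 2 A)

/-- The inclusion of the Borel subgroup in a member of the amalgam. -/
def borelHom (i : Fin 2) : 𝒜.borel 0 →* 𝒜.P i :=
  MonoidHom.mk' (fun b => ⟨b.1.1, Set.mem_iInter.1 b.2 i⟩) fun x y =>
    Subtype.ext (𝒜.mul_compat 0 i x.1.1 y.1.1 _ _ _ _)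

theorem borelHom_injective (i : Fin 2) : Function.Injective (𝒜.borelHom i) :=
  fun _ _ h => Subtype.ext (Subtype.ext (congrArg (fun x : 𝒜.P i => (x : A)) h))

theorem mem_range_borelHom {i : Fin 2} {p : 𝒜.P i} : p ∈ (𝒜.borelHom i).range ↔ p ∈ 𝒜.borel i := by
  constructor
  · rintro ⟨b, rfl⟩
    exact b.2
  · intro hp
    exact ⟨⟨⟨p, Set.mem_iInter.1 hp 0⟩, hp⟩, rfl⟩

/-- The universal completion of the amalgam. -/
abbrev UniversalCompletion : Type _ := PushoutI 𝒜.borelHom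

/-- The canonical map of a member of the amalgam to the universal completion. -/
def toUniversal (i : Fin 2) : 𝒜.P i →* 𝒜.UniversalCompletion :=
  PushoutI.of (φ := 𝒜.borelHom) i

theorem toUniversal_injective (i : Fin 2) : Function.Injective (𝒜.toUniversal i) :=
  PushoutI.of_injective 𝒜.borelHom_injective i

theorem toUniversal_borelHom (i : Fin 2) (b : 𝒜.borel 0) :
    𝒜.toUniversal i (𝒜.borelHom i b) = PushoutI.base 𝒜.borelHom b :=
  PushoutI.of_apply_eq_base 𝒜.borelHom i b

theorem iSup_range_of_pushout :
    ⨆ i, (𝒜.toUniversal i).range = ⊤ := by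
  rw [eq_top_iff]
  intro x _
  induction x using PushoutI.induction_on with
  | of i g => exact Subgroup.mem_iSup_of_mem i ⟨g, rfl⟩
  | base h =>
    rw [← 𝒜.toUniversal_borelHom 0]
    exact Subgroup.mem_iSup_of_mem 0 ⟨_, rfl⟩
  | mul x y hx hy => exact mul_mem (hx trivial) (hy trivial)

theorem of_pushout_eq (i j : Fin 2) (x : A) (hi : x ∈ 𝒜.P i) (hj : x ∈ 𝒜.P j) :
    (𝒜.toUniversal i ⟨x, hi⟩ ) = 𝒜.toUniversal j ⟨x, hj⟩ := by
  obtain rfl | hij := eq_or_ne i j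
  · rfl
  · have hx : x ∈ ⋂ i, 𝒜.P i := by
      rw [Set.mem_iInter]
      intro l
      have : l = i ∨ l = j := by omega
      obtain rfl | rfl := this <;> assumption
    let b : 𝒜.borel 0 := ⟨⟨x, Set.mem_iInter.1 hx 0⟩, hx⟩
    exact (𝒜.toUniversal_borelHom i b).trans
      (𝒜.toUniversal_borelHom j b).symm

/-- Compatibility and generation descend to every quotient of the universal completion; only
injectivity and the intersection condition can fail. -/
theorem isCompletion_of_surjective {Q : Type*} [Group Q] (π : 𝒜.UniversalCompletion →* Q)
    (hπ : Function.Surjective π)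
    (hinj : ∀ i, Function.Injective (π.comp (𝒜.toUniversal i)))
    (hmem : ∀ i j, i ≠ j → ∀ p q, π (𝒜.toUniversal i p) = π (𝒜.toUniversal j q) → p ∈ 𝒜.borel i) :
    𝒜.IsCompletion fun i => π.comp (𝒜.toUniversal i) where
  injective := hinj
  compat i j x hi hj := congrArg π (𝒜.of_pushout_eq i j x hi hj)
  mem_borel := hmem
  iSup_range := by
    simp_rw [MonoidHom.range_comp]
    rw [← Subgroup.map_iSup, iSup_range_of_pushout, Subgroup.map_top_of_surjective π hπ]

/-- In an amalgamated product the factors embed and meet exactly in the base. -/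
theorem isCompletion_universal :
    𝒜.IsCompletion 𝒜.toUniversal := by
  refine 𝒜.isCompletion_of_surjective (MonoidHom.id _) Function.surjective_id
    𝒜.toUniversal_injective fun i j hij p q h => ?_
  have hp : 𝒜.toUniversal i p ∈ (PushoutI.base 𝒜.borelHom).range := by
    rw [← PushoutI.inf_of_range_eq_base_range 𝒜.borelHom_injective hij]
    exact ⟨⟨p, rfl⟩, ⟨q, h.symm⟩⟩
  obtain ⟨b, hb⟩ := hp
  rw [← 𝒜.toUniversal_borelHom i] at hb
  rw [← mem_range_borelHom]
  exact ⟨b, 𝒜.toUniversal_injective i hb⟩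

theorem exists_finite_completion {A : Type} (𝒜 : Amalgam 2 A) :
    ∃ (Q : Type) (_ : Group Q) (_ : Finite Q) (f : ∀ i, 𝒜.P i →* Q), 𝒜.IsCompletion f := by
  have := 𝒜.finite
  obtain ⟨X, hX, θ, hinj, hmem⟩ :=
    exists_finite_permRep (G := fun i => 𝒜.P i) 𝒜.borelHom_injective
  refine ⟨θ.range, inferInstance, inferInstance, _,
    𝒜.isCompletion_of_surjective θ.rangeRestrict θ.rangeRestrict_surjective (fun i p q h => ?_)
      fun i j hij p q h => ?_⟩
  · exact hinj i (congrArg Subtype.val h)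
  · exact 𝒜.mem_range_borelHom.1 (hmem i j hij p q (congrArg Subtype.val h))

end Amalgam

/-! ### The coset graph of the universal completion is a tree. -/

namespace Amalgam

open Monoid

variable {A : Type*} (𝒜 : Amalgam 2 A)

/-- The product of a word in the universal completion. -/
def wordProd (L : List (Σ i, 𝒜.P i)) : 𝒜.UniversalCompletion :=
  (L.map fun l => 𝒜.toUniversal l.1 l.2).prod

theorem wordProd_cons (l : Σ i, 𝒜.P i) (L : List (Σ i, 𝒜.P i)) :
    𝒜.wordProd (l :: L) = 𝒜.toUniversal l.1 l.2 * 𝒜.wordProd L := by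
  simp [wordProd]

theorem wordProd_concat (L : List (Σ i, 𝒜.P i)) (l : Σ i, 𝒜.P i) :
    𝒜.wordProd (L ++ [l]) = 𝒜.wordProd L * 𝒜.toUniversal l.1 l.2 := by
  simp [wordProd]

/-- A nonempty word with letters outside the Borel subgroup taken alternately from the members of
the amalgam does not represent an element of the Borel subgroup. -/
theorem eq_nil_of_wordProd_mem {L : List (Σ i, 𝒜.P i)} (hL : ∀ l ∈ L, l.2 ∉ 𝒜.borel l.1)
    (hc : (L.map Sigma.fst).IsChain (· ≠ ·)) {i : Fin 2} {p : 𝒜.P i} (hp : p ∈ 𝒜.borel i)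
    (h : 𝒜.wordProd L = 𝒜.toUniversal i p) : L = [] := by
  -- The letters avoid the Borel subgroup, so the word is reduced; by the normal form theorem only
  -- the empty reduced word lies in the base.
  let w : CoprodI.Word (fun i => 𝒜.P i) :=
    ⟨L, fun l hl h1 => hL l hl (h1 ▸ one_mem _), (List.isChain_map _).1 hc⟩
  have hred : PushoutI.Reduced 𝒜.borelHom w := fun l hl =>
    mt 𝒜.mem_range_borelHom.1 (hL l hl)
  have hw : PushoutI.ofCoprodI w.prod = 𝒜.wordProd L := by
    rw [CoprodI.Word.prod, map_list_prod, List.map_map, wordProd]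
    rfl
  obtain ⟨b, rfl⟩ := 𝒜.mem_range_borelHom.2 hp
  have := hred.eq_empty_of_mem_range 𝒜.borelHom_injective
    ⟨b, by rw [hw, h, toUniversal_borelHom]⟩
  exact congrArg CoprodI.Word.toList this

/-- The coset graph of the universal completion. -/
abbrev treeGraph : SimpleGraph (Σ i, 𝒜.UniversalCompletion ⧸ (𝒜.toUniversal i).range) :=
  cosetGraph fun i => (𝒜.toUniversal i).range

/-- The vertices of the coset graph of the universal completion. -/
abbrev treeVertex (i : Fin 2) (g : 𝒜.UniversalCompletion) :
    Σ i, 𝒜.UniversalCompletion ⧸ (𝒜.toUniversal i).range :=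
  cosetVertex (fun i => (𝒜.toUniversal i).range) i g

/-- Consecutive edges at a vertex `b` are the edges of `g` and `g x` with `x` in the member indexed
by `b`. If `x` were in the Borel subgroup, the second edge would lead back to `a`. A path without
backtracking thus spells an alternating word, with one letter for each vertex but the last. -/
theorem exists_word_of_isPath {a b c : Σ i, 𝒜.UniversalCompletion ⧸ (𝒜.toUniversal i).range}
    (hab : a.1 ≠ b.1) (p : 𝒜.treeGraph.Walk b c) (hp : p.IsPath) (hne : p.snd ≠ a)
    {g : 𝒜.UniversalCompletion} (ha : a = 𝒜.treeVertex a.1 g) (hb : b = 𝒜.treeVertex b.1 g) :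
    ∃ L : List (Σ i, 𝒜.P i), (∀ l ∈ L, l.2 ∉ 𝒜.borel l.1) ∧
      L.map Sigma.fst ++ [c.1] = p.support.map Sigma.fst ∧
      c = 𝒜.treeVertex c.1 (g * 𝒜.wordProd L) := by
  induction p generalizing a g with
  | nil => exact ⟨[], by simp, by simp, by simpa [wordProd] using hb⟩
  | @cons b d c h p ih =>
    rw [SimpleGraph.Walk.cons_isPath_iff] at hp
    rw [SimpleGraph.Walk.snd_cons] at hne
    obtain ⟨hbd, g', hb', hd⟩ := (cosetGraph_adj_iff _).1 h
    obtain ⟨x, hx⟩ := (cosetVertex_eq_iff (fun i => (𝒜.toUniversal i).range)).1 (hb.symm.trans hb')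
    have hg' : g' = g * 𝒜.toUniversal b.1 x := by rw [hx, mul_inv_cancel_left]
    obtain ⟨L, hL, hidx, hc⟩ := ih hbd hp.1
      (fun e => hp.2 (e ▸ p.getVert_mem_support 1)) hb' hd
    refine ⟨⟨b.1, x⟩ :: L, ?_, ?_, ?_⟩
    · simp only [List.mem_cons, forall_eq_or_imp]
      refine ⟨fun hxb => hne ?_, hL⟩
      have had : d.1 = a.1 := by omega
      rw [hd, ha, had]
      refine ((cosetVertex_eq_iff _).2 ?_).symm
      rw [← hx]
      exact (𝒜.isCompletion_universal.mem_borel_iff hab.symm x).1 hxb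
    · rw [List.map_cons, List.cons_append, hidx, SimpleGraph.Walk.support_cons, List.map_cons]
    · rw [wordProd_cons, ← mul_assoc, ← hg']
      exact hc

/-- A cycle at `a` spells an alternating word whose product `q` lies in the member indexed by `a`.
Either `q` is in the Borel subgroup, or appending `q⁻¹` gives a longer alternating word with product
`1`; both contradict the normal form. -/
theorem treeGraph_isAcyclic : 𝒜.treeGraph.IsAcyclic := by
  intro a c hc
  cases c with
  | nil => exact hc.ne_nil rfl
  | @cons _ b _ h p =>
    rw [SimpleGraph.Walk.cons_isCycle_iff] at hc
    obtain ⟨hab, g, ha, hb⟩ := (cosetGraph_adj_iff _).1 h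
    -- Otherwise the cycle would immediately retrace its first edge.
    have hne : p.snd ≠ a := by
      cases p with
      | nil => exact fun _ => hab rfl
      | cons h' p' =>
        rw [SimpleGraph.Walk.snd_cons]
        rintro rfl
        exact hc.2 (by simp [Sym2.eq_swap])
    obtain ⟨L, hL, hidx, hcL⟩ := 𝒜.exists_word_of_isPath hab p hc.1 hne ha hb
    have hchain : (L.map Sigma.fst ++ [a.1]).IsChain (· ≠ ·) := by
      rw [hidx, List.isChain_map]
      exact p.isChain_adj_support.imp fun _ _ h => h.1
    obtain ⟨q, hq⟩ := (cosetVertex_eq_iff (fun i => (𝒜.toUniversal i).range)).1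
      (ha.symm.trans hcL)
    rw [inv_mul_cancel_left] at hq
    by_cases hqB : q ∈ 𝒜.borel a.1
    -- An empty word forces `b` to have the type of `a`, although they are adjacent.
    · have hnil := 𝒜.eq_nil_of_wordProd_mem hL hchain.left_of_append hqB hq.symm
      subst hnil
      rw [← SimpleGraph.Walk.cons_tail_support, List.map_cons] at hidx
      exact hab (List.cons.inj hidx).1
    · have hnil := 𝒜.eq_nil_of_wordProd_mem (L := L ++ [⟨a.1, q⁻¹⟩]) (i := 0) (p := 1)
        (by
          simp only [List.mem_append, List.mem_singleton]
          rintro l (hl | rfl)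
          · exact hL l hl
          · rwa [inv_mem_iff])
        (by simpa using hchain) (one_mem _)
        (by rw [wordProd_concat, ← hq, map_inv, mul_inv_cancel, map_one])
      simp at hnil

theorem treeGraph_isTree : 𝒜.treeGraph.IsTree where
  connected := cosetGraph_connected _ 𝒜.isCompletion_universal.iSup_range
  isAcyclic := 𝒜.treeGraph_isAcyclic

end Amalgam

/-! ### Infiniteness of the tree and the equivalence. -/

theorem PermIso.nontrivial_points {Ω Δ : Type*} {L : Subgroup (Equiv.Perm Ω)}
    {M : Subgroup (Equiv.Perm Δ)} (h : PermIso L M) (hM : Nontrivial M) : Nontrivial Ω := by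
  obtain ⟨e, -, -⟩ := h
  by_contra hΩ
  rw [not_nontrivial_iff_subsingleton] at hΩ
  have : Subsingleton Δ := e.symm.subsingleton
  exact not_subsingleton M inferInstance

/-- If the local groups are nontrivial, a tree has no leaves and is therefore infinite. -/
theorem IsLocallyPair.infinite {V : Type*} {Γ : SimpleGraph V} {G : Subgroup (Γ ≃g Γ)}
    {Ω₁ Ω₂ : Type*} {L₁ : Subgroup (Equiv.Perm Ω₁)} {L₂ : Subgroup (Equiv.Perm Ω₂)}
    (h : IsLocallyPair Γ G L₁ L₂) (hΓ : Γ.IsTree) (hL₁ : Nontrivial L₁) (hL₂ : Nontrivial L₂) :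
    Infinite V := by
  obtain ⟨u, v, huv, h₁, h₂⟩ := h.exists_edge
  have hu := h₁.nontrivial_points hL₁
  have hv := h₂.nontrivial_points hL₂
  -- Every vertex is a translate of `u` or `v`, and a nontrivial permutation group needs two points;
  -- a finite tree with an edge would have a leaf.
  have hall : ∀ x, Nontrivial (Γ.neighborSet x) := by
    intro x
    have key : ∀ (k : Γ ≃g Γ) w, Nontrivial (Γ.neighborSet w) →
        Nontrivial (Γ.neighborSet (k w)) := fun k w hw => (k.mapNeighborSet w).symm.nontrivial
    have ht := h.locallyTransitive
    obtain ⟨k, -, rfl | rfl⟩ := exists_mem_eq_or_eq (K := G) h.connected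
      (fun x hx => (ht.exists_mem_adj huv x hx).imp fun g hg => ⟨hg.1.1, hg.1.2, hg.2⟩)
      (fun x hx => (ht.exists_mem_adj huv.symm x hx).imp fun g hg => ⟨hg.1.1, hg.1.2, hg.2⟩) x
    · exact key k u hu
    · exact key k v hv
  by_contra hfin
  rw [not_infinite_iff_finite] at hfin
  classical
  have := Fintype.ofFinite V
  have : Nontrivial V := ⟨u, v, huv.ne⟩
  obtain ⟨x, hx⟩ := hΓ.exists_vert_degree_one_of_nontrivial
  rw [← SimpleGraph.card_neighborSet_eq_degree] at hx
  have := Fintype.one_lt_card_iff_nontrivial.2 (hall x)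
  omega

theorem lemma2p1 {Ω₁ Ω₂ B : Type*} [Finite Ω₁] [Finite Ω₂] [Group B] [Finite B]
    (L₁ : Subgroup (Equiv.Perm Ω₁)) (L₂ : Subgroup (Equiv.Perm Ω₂))
    (hL₁ : Nontrivial L₁) (hL₂ : Nontrivial L₂)
    (htrans₁ : MulAction.IsPretransitive L₁ Ω₁) (htrans₂ : MulAction.IsPretransitive L₂ Ω₂) :
    List.TFAE [
      ∃ (A : Type) (𝒜 : Amalgam 2 A), 𝒜.Faithful ∧ 𝒜.HasPermType L₁ L₂ ∧ 𝒜.HasBorel B,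
      ∃ (V : Type) (T : SimpleGraph V) (G : Subgroup (T ≃g T)),
        IsLocallyPair T G L₁ L₂ ∧ T.IsTree ∧ Infinite V ∧
          ∃ u v, T.Adj u v ∧ Nonempty (edgeStab T G u v ≃* B),
      ∃ (V : Type) (Γ : SimpleGraph V) (H : Subgroup (Γ ≃g Γ)),
        IsLocallyPair Γ H L₁ L₂ ∧ Finite V ∧
          ∃ u v, Γ.Adj u v ∧ Nonempty (edgeStab Γ H u v ≃* B)] := by
  tfae_have 1 → 2 := by
    rintro ⟨A, 𝒜, hF, hL, hB⟩
    have hf := 𝒜.isCompletion_universal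
    have hpair := hf.isLocallyPair hL
    obtain ⟨e⟩ := hf.nonempty_edgeStab_mulEquiv hF
    obtain ⟨eB⟩ := hB 0
    exact ⟨_, _, _, hpair, 𝒜.treeGraph_isTree, hpair.infinite 𝒜.treeGraph_isTree hL₁ hL₂, _, _,
      cosetGraph_adj_cosetVertex _ zero_ne_one 1, ⟨e.symm.trans eB⟩⟩
  tfae_have 1 → 3 := by
    rintro ⟨A, 𝒜, hF, hL, hB⟩
    obtain ⟨Q, _, _, f, hf⟩ := 𝒜.exists_finite_completion
    obtain ⟨e⟩ := hf.nonempty_edgeStab_mulEquiv hF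
    obtain ⟨eB⟩ := hB 0
    exact ⟨_, _, _, hf.isLocallyPair hL, inferInstance, _, _,
      cosetGraph_adj_cosetVertex _ zero_ne_one 1, ⟨e.symm.trans eB⟩⟩
  tfae_have 2 → 1 := by
    rintro ⟨V, T, G, h, -, -, u, v, huv, hB⟩
    exact h.exists_amalgam huv hB
  tfae_have 3 → 1 := by
    rintro ⟨V, Γ, H, h, -, u, v, huv, hB⟩
    exact h.exists_amalgam huv hB
  tfae_finish
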